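/- A map $\mathcal M$ (a 2-cell embedding of a finite connected graph, possibly with loops or multiple edges but with at least one edge, in a closed surface) is described by its finite non-empty set of flags $\mathcal F(\mathcal M)$ with fixed-point-free involutions $s_0,s_1,s_2$ taking each flag to its $i$-adjacent flag, such that $s_0s_2=s_2s_0$ is fixed-point free and $\langle s_0,s_1,s_2\rangle$ is transitive on flags. Edges are the orbits of $\langle s_0,s_2\rangle$; the automorphism group $\Gamma(\mathcal M)$ consists of the permutations of the flags commuting with $s_0,s_1,s_2$; $\mathcal M$ is edge-transitive if $\Gamma(\mathcal M)$ is transitive on edges. The symmetry type graph $T(\mathcal M)$ is the pregraph with edges coloured $0,1,2$ whose vertices are the flag orbits of $\Gamma(\mathcal M)$, two orbits being joined by an edge of colour $i$ (a semi-edge if they coincide) iff some flag of one is $i$-adjacent to some flag of the other. The medial map $Me(\mathcal M)$ has flag set $\mathcal F(\mathcal M)\times\{0,2\}$ and adjacencies $$(\Phi,j)S_0=(\Phi s_1,j),\quad (\Phi,0)S_1=(\Phi s_2,0),\quad (\Phi,2)S_1=(\Phi s_0,2),\quad (\Phi,j)S_2=(\Phi,2-j).$$ Consider the following 14 coloured pregraphs,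 each colour $i$ being given by an involution or identity $t_i$ on the vertices (fixed points are semi-edges): - type $1$: one vertex with three semi-edges; - types $2, 2_0, 2_1, 2_2, 2_{01}, 2_{12}$: two vertices, where the colours listed in the subscript are semi-edges at both vertices and every other colour is an edge joining the two vertices; - seven types on the vertices $0,1,2,3$ with $t_0=(0\,1)(2\,3)$ and $t_2=(0\,3)(1\,2)$, and with $t_1=\mathrm{id}$ ($4_F$), $t_1=t_0$ ($4_G$), $t_1=t_2$ ($4_{Gd}$), $t_1=t_0t_2$ ($4_{Gp}$), $t_1=(0\,1)$ ($4_H$), $t_1=(0\,3)$ ($4_{Hd}$), $t_1=(0\,2)$ ($4_{Hp}$). **Theorem.** These 14 graphs are pairwise non-isomorphic (as coloured pregraphs), the symmetry type graph of every edge-transitive map is isomorphic to one of them, and each of them is the symmetry type graph of an edge-transitive medial map; that is, for each of these 14 graphs $T$ there is a map $\mathcal M$ such that $Me(\mathcal M)$ is edge-transitive and $T(Me(\mathcal M))\cong T$. -/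

import Mathlib

universe u v

/-- A map on a closed surface, given by its finite flag graph: `s i Φ` is the flag that is
`i`-adjacent to `Φ`, and the `s i` are the distinguished generators of the monodromy group.
Loops, multiple edges and non-orientable surfaces are allowed. -/
structure SurfaceMap where
  Flag : Type u
  finite : Finite Flag
  nonempty : Nonempty Flag
  s : Fin 3 → Equiv.Perm Flag
  involutive : ∀ i Φ, s i (s i Φ) = Φ
  s_ne : ∀ i Φ, s i Φ ≠ Φ
  comm : ∀ Φ, s 0 (s 2 Φ) = s 2 (s 0 Φ)
  s_zero_two_ne : ∀ Φ, s 0 (s 2 Φ) ≠ Φ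
  connected : MulAction.IsPretransitive (Subgroup.closure (Set.range s)) Flag

namespace SurfaceMap

/-- The automorphism group: the permutations of the flags that commute with every `s i`. -/
def aut (M : SurfaceMap.{u}) : Subgroup (Equiv.Perm M.Flag) :=
  Subgroup.centralizer (Set.range M.s)

/-- The edge of a flag, as the set of all flags that contain it. -/
def edge (M : SurfaceMap.{u}) (Φ : M.Flag) : Set M.Flag :=
  MulAction.orbit (Subgroup.closure {M.s 0, M.s 2}) Φ

/-- The automorphism group is transitive on edges. -/
def IsEdgeTransitive (M : SurfaceMap.{u}) : Prop :=
  ∀ Φ Ψ : M.Flag, ∃ γ ∈ M.aut, γ '' M.edge Φ = M.edge Ψ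

end SurfaceMap

/-- A pregraph with edges coloured `0, 1, 2` and at most one edge of each colour between two
vertices; `adj i v v` means that there is a semi-edge of colour `i` at `v`. -/
structure ColouredPregraph where
  V : Type u
  adj : Fin 3 → V → V → Prop
  symm : ∀ i v w, adj i v w → adj i w v

namespace ColouredPregraph

/-- Colour-preserving isomorphism of coloured pregraphs. -/
def IsIso (G : ColouredPregraph.{u}) (H : ColouredPregraph.{v}) : Prop :=
  ∃ e : G.V ≃ H.V, ∀ i x y, G.adj i x y ↔ H.adj i (e x) (e y)

/-- The pregraph on `k` vertices whose edge (or semi-edge) of colour `i` at `x` leads to `t i x`. -/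
def ofInvolutions (k : ℕ) (t : Fin 3 → Fin k → Fin k) (h : ∀ i x, t i (t i x) = x) :
    ColouredPregraph.{0} where
  V := Fin k
  adj i x y := t i x = y
  symm i x y hxy := by rw [← hxy, h]

end ColouredPregraph

namespace SurfaceMap

/-- The symmetry type graph: its vertices are the flag orbits of the automorphism group, and two
orbits are joined by an edge of colour `i` iff some flag of the first is `i`-adjacent to some flag
of the second (a semi-edge if the orbits coincide). -/
def symmetryTypeGraph (M : SurfaceMap.{u}) : ColouredPregraph.{u} where
  V := MulAction.orbitRel.Quotient M.aut M.Flag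
  adj i O P := ∃ Φ Ψ : M.Flag, Quotient.mk _ Φ = O ∧ Quotient.mk _ Ψ = P ∧ M.s i Φ = Ψ
  symm := by
    rintro i O P ⟨Φ, Ψ, hO, hP, h⟩
    exact ⟨Ψ, Φ, hP, hO, by rw [← h, M.involutive]⟩

/-- Adjacency of the flags of the medial map. A flag `Φ = (v, e, f)` of `M` is cut into the flags
`(Φ, false) = (e, {v, f}, v)` and `(Φ, true) = (e, {v, f}, f)`. -/
def medialAdj (M : SurfaceMap.{u}) : Fin 3 → M.Flag × Bool → M.Flag × Bool :=
  ![fun x => (M.s 1 x.1, x.2),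
    fun x => (bif x.2 then M.s 0 x.1 else M.s 2 x.1, x.2),
    fun x => (x.1, !x.2)]

theorem medialAdj_involutive (M : SurfaceMap.{u}) (i : Fin 3) :
    Function.Involutive (M.medialAdj i) := by
  rintro ⟨Φ, b⟩
  fin_cases i <;> cases b <;> simp [medialAdj, M.involutive]

def medialPerm (M : SurfaceMap.{u}) (i : Fin 3) : Equiv.Perm (M.Flag × Bool) :=
  (M.medialAdj_involutive i).toPerm

theorem medial_connected (M : SurfaceMap.{u}) :
    MulAction.IsPretransitive (Subgroup.closure (Set.range M.medialPerm)) (M.Flag × Bool) := by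
  let H := Subgroup.closure (Set.range M.medialPerm)
  have hS : ∀ i, M.medialPerm i ∈ H := fun i => Subgroup.subset_closure ⟨i, rfl⟩
  have hgen : ∀ i, ∃ h ∈ H, ∀ Φ : M.Flag, h (Φ, false) = (M.s i Φ, false) := by
    intro i
    fin_cases i
    · refine ⟨M.medialPerm 2 * M.medialPerm 1 * M.medialPerm 2,
        H.mul_mem (H.mul_mem (hS 2) (hS 1)) (hS 2), fun Φ => ?_⟩
      simp [medialPerm, medialAdj]
    · exact ⟨M.medialPerm 0, hS 0, fun Φ => by simp [medialPerm, medialAdj]⟩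
    · exact ⟨M.medialPerm 1, hS 1, fun Φ => by simp [medialPerm, medialAdj]⟩
  have hmon : ∀ g ∈ Subgroup.closure (Set.range M.s),
      ∃ h ∈ H, ∀ Φ : M.Flag, h (Φ, false) = (g Φ, false) := by
    intro g hg
    induction hg using Subgroup.closure_induction with
    | mem x hx => obtain ⟨i, rfl⟩ := hx; exact hgen i
    | one => exact ⟨1, H.one_mem, fun Φ => rfl⟩
    | mul x y _ _ hx hy =>
      obtain ⟨a, ha, ha'⟩ := hx
      obtain ⟨b, hb, hb'⟩ := hy
      exact ⟨a * b, H.mul_mem ha hb, fun Φ => by simp [hb', ha']⟩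
    | inv x _ hx =>
      obtain ⟨a, ha, ha'⟩ := hx
      refine ⟨a⁻¹, H.inv_mem ha, fun Φ => ?_⟩
      rw [Equiv.Perm.inv_eq_iff_eq, ha']
      simp
  have hflip : ∀ x : M.Flag × Bool, ∃ h ∈ H, h (x.1, false) = x := by
    rintro ⟨Φ, b⟩
    cases b
    · exact ⟨1, H.one_mem, rfl⟩
    · exact ⟨M.medialPerm 2, hS 2, by simp [medialPerm, medialAdj]⟩
  refine ⟨fun x y => ?_⟩
  obtain ⟨a, ha, hax⟩ := hflip x
  obtain ⟨b, hb, hby⟩ := hflip y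
  obtain ⟨⟨g, hg⟩, hgxy⟩ := M.connected.exists_smul_eq x.1 y.1
  obtain ⟨c, hc, hc'⟩ := hmon g hg
  refine ⟨⟨b * c * a⁻¹, H.mul_mem (H.mul_mem hb hc) (H.inv_mem ha)⟩, ?_⟩
  have hga : a⁻¹ x = (x.1, false) := by rw [Equiv.Perm.inv_eq_iff_eq, hax]
  have hgy : g x.1 = y.1 := hgxy
  change b (c (a⁻¹ x)) = y
  rw [hga, hc', hgy, hby]

/-- The medial map `Me(M)`. -/
def medial (M : SurfaceMap.{u}) : SurfaceMap.{u} where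
  Flag := M.Flag × Bool
  finite := by have := M.finite; infer_instance
  nonempty := by have := M.nonempty; infer_instance
  s := M.medialPerm
  involutive i := M.medialAdj_involutive i
  s_ne := by
    rintro i ⟨Φ, b⟩
    fin_cases i <;> cases b <;> simp [medialPerm, medialAdj, M.s_ne]
  comm := by
    rintro ⟨Φ, b⟩
    simp [medialPerm, medialAdj]
  s_zero_two_ne := by
    rintro ⟨Φ, b⟩
    simp [medialPerm, medialAdj]
  connected := M.medial_connected

end SurfaceMap

open ColouredPregraph in
/-- The fourteen edge-transitive symmetry type graphs, in the order
`1`, `2`, `2_0`, `2_1`, `2_2`, `2_{01}`, `2_{12}`,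
`4_F`, `4_G`, `4_{Gd}`, `4_{Gp}`, `4_H`, `4_{Hd}`, `4_{Hp}`.
The three rows of each entry describe the edges and semi-edges of colours `0`, `1`, `2`. -/
def edgeTransitiveTypeGraph : Fin 14 → ColouredPregraph.{0} :=
  ![ofInvolutions 1 ![![0], ![0], ![0]] (by decide),
    ofInvolutions 2 ![![1, 0], ![1, 0], ![1, 0]] (by decide),
    ofInvolutions 2 ![![0, 1], ![1, 0], ![1, 0]] (by decide),
    ofInvolutions 2 ![![1, 0], ![0, 1], ![1, 0]] (by decide),
    ofInvolutions 2 ![![1, 0], ![1, 0], ![0, 1]] (by decide),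
    ofInvolutions 2 ![![0, 1], ![0, 1], ![1, 0]] (by decide),
    ofInvolutions 2 ![![1, 0], ![0, 1], ![0, 1]] (by decide),
    ofInvolutions 4 ![![1, 0, 3, 2], ![0, 1, 2, 3], ![3, 2, 1, 0]] (by decide),
    ofInvolutions 4 ![![1, 0, 3, 2], ![1, 0, 3, 2], ![3, 2, 1, 0]] (by decide),
    ofInvolutions 4 ![![1, 0, 3, 2], ![3, 2, 1, 0], ![3, 2, 1, 0]] (by decide),
    ofInvolutions 4 ![![1, 0, 3, 2], ![2, 3, 0, 1], ![3, 2, 1, 0]] (by decide),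
    ofInvolutions 4 ![![1, 0, 3, 2], ![1, 0, 2, 3], ![3, 2, 1, 0]] (by decide),
    ofInvolutions 4 ![![1, 0, 3, 2], ![3, 1, 2, 0], ![3, 2, 1, 0]] (by decide),
    ofInvolutions 4 ![![1, 0, 3, 2], ![2, 1, 0, 3], ![3, 2, 1, 0]] (by decide)]

namespace SurfaceMap

variable {M : SurfaceMap.{u}}

theorem mem_aut_iff {γ : Equiv.Perm M.Flag} :
    γ ∈ M.aut ↔ ∀ i Φ, γ (M.s i Φ) = M.s i (γ Φ) := by
  simp only [aut, Subgroup.mem_centralizer_iff, Set.forall_mem_range, Equiv.ext_iff,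
    Equiv.Perm.mul_apply]
  exact forall₂_congr fun _ _ => eq_comm

/-- Connectedness of the flag graph as an induction principle. -/
theorem flag_induction {p : M.Flag → Prop} (Φ : M.Flag) (base : p Φ)
    (step : ∀ i Ψ, p Ψ → p (M.s i Ψ)) (Ψ : M.Flag) : p Ψ := by
  obtain ⟨⟨g, hg⟩, rfl⟩ := M.connected.exists_smul_eq Φ Ψ
  change p (g Φ)
  induction hg using Subgroup.closure_induction'' generalizing Φ with
  | mem x hx => obtain ⟨i, rfl⟩ := hx; exact step i Φ base
  | inv_mem x hx =>
    obtain ⟨i, rfl⟩ := hx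
    have : (M.s i)⁻¹ Φ = M.s i Φ := by rw [Equiv.Perm.inv_eq_iff_eq, M.involutive]
    rw [this]
    exact step i Φ base
  | one => exact base
  | mul x y _ _ hx hy => exact hx _ (hy _ base)

theorem exists_mem_aut_of_commute (f : M.Flag → M.Flag)
    (hf : ∀ i Φ, f (M.s i Φ) = M.s i (f Φ)) : ∃ γ ∈ M.aut, ∀ Φ, γ Φ = f Φ := by
  have := M.finite
  obtain ⟨Φ⟩ := M.nonempty
  have hsurj : Function.Surjective f :=
    flag_induction (f Φ) ⟨Φ, rfl⟩ (by rintro i _ ⟨Ψ, rfl⟩; exact ⟨M.s i Ψ, hf i Ψ⟩)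
  exact ⟨Equiv.ofBijective f (Finite.surjective_iff_bijective.1 hsurj),
    mem_aut_iff.2 hf, fun _ => rfl⟩

/-- If the flags of `M` embed equivariantly into a set with a larger symmetry group, then every
symmetry that maps one flag of `M` to another restricts to an automorphism of `M`. -/
theorem exists_mem_aut_of_embedding {Y : Type v} {S : Fin 3 → Y → Y} {ι : M.Flag → Y}
    (hι : Function.Injective ι) (hS : ∀ i Φ, ι (M.s i Φ) = S i (ι Φ)) {g : Y → Y}
    (hg : ∀ i y, g (S i y) = S i (g y)) {Φ Ψ : M.Flag} (h : g (ι Φ) = ι Ψ) :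
    ∃ γ ∈ M.aut, γ Φ = Ψ := by
  have hex : ∀ Θ, ∃ Θ', ι Θ' = g (ι Θ) :=
    flag_induction Φ ⟨Ψ, h.symm⟩ fun i Θ ⟨Θ', hΘ⟩ => ⟨M.s i Θ', by rw [hS, hΘ, hS, hg]⟩
  choose f hf using hex
  obtain ⟨γ, hγ, hγf⟩ := exists_mem_aut_of_commute f fun i Θ => hι <| by
    rw [hf, hS, hg, hS, hf]
  exact ⟨γ, hγ, hι <| by rw [hγf, hf, h]⟩

theorem s_mem_edge {Φ Ψ : M.Flag} (i : Fin 3) (hi : i = 0 ∨ i = 2) (h : Ψ ∈ M.edge Φ) :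
    M.s i Ψ ∈ M.edge Φ := by
  obtain ⟨g, rfl⟩ := h
  refine ⟨⟨M.s i, Subgroup.subset_closure ?_⟩ * g, rfl⟩
  rcases hi with rfl | rfl <;> simp

theorem mem_edge_iff {Φ Ψ : M.Flag} :
    Ψ ∈ M.edge Φ ↔ Ψ = Φ ∨ Ψ = M.s 0 Φ ∨ Ψ = M.s 2 Φ ∨ Ψ = M.s 0 (M.s 2 Φ) := by
  constructor
  · rintro ⟨⟨g, hg⟩, rfl⟩
    change g Φ = Φ ∨ g Φ = M.s 0 Φ ∨ g Φ = M.s 2 Φ ∨ g Φ = M.s 0 (M.s 2 Φ)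
    have hcl : ∀ x ∈ ({M.s 0, M.s 2} : Set (Equiv.Perm M.Flag)), ∀ Ψ,
        (Ψ = Φ ∨ Ψ = M.s 0 Φ ∨ Ψ = M.s 2 Φ ∨ Ψ = M.s 0 (M.s 2 Φ)) →
        (x Ψ = Φ ∨ x Ψ = M.s 0 Φ ∨ x Ψ = M.s 2 Φ ∨ x Ψ = M.s 0 (M.s 2 Φ)) := by
      have h0 := M.involutive 0
      have h2 := M.involutive 2
      have hc := M.comm
      rintro x (rfl | rfl) Ψ (rfl | rfl | rfl | rfl) <;> simp [h0, h2, ← hc]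
    suffices ∀ Ψ, (Ψ = Φ ∨ Ψ = M.s 0 Φ ∨ Ψ = M.s 2 Φ ∨ Ψ = M.s 0 (M.s 2 Φ)) →
        (g Ψ = Φ ∨ g Ψ = M.s 0 Φ ∨ g Ψ = M.s 2 Φ ∨ g Ψ = M.s 0 (M.s 2 Φ)) from
      this Φ (Or.inl rfl)
    induction hg using Subgroup.closure_induction'' with
    | mem x hx => exact hcl x hx
    | inv_mem x hx =>
      have : x⁻¹ = x := by
        ext Ψ
        rw [Equiv.Perm.inv_eq_iff_eq]
        rcases hx with rfl | rfl <;> exact (M.involutive _ _).symm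
      rw [this]
      exact hcl x hx
    | one => exact fun _ h => h
    | mul x y _ _ hx hy => exact fun Ψ h => hx _ (hy _ h)
  · have h : Φ ∈ M.edge Φ := MulAction.mem_orbit_self Φ
    rintro (rfl | rfl | rfl | rfl)
    · exact h
    · exact s_mem_edge 0 (by simp) h
    · exact s_mem_edge 2 (by simp) h
    · exact s_mem_edge 0 (by simp) (s_mem_edge 2 (by simp) h)

theorem image_edge {γ : Equiv.Perm M.Flag} (hγ : γ ∈ M.aut) (Φ : M.Flag) :
    γ '' M.edge Φ = M.edge (γ Φ) := by
  rw [mem_aut_iff] at hγ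
  ext Ψ
  simp only [Set.mem_image, mem_edge_iff]
  constructor
  · rintro ⟨Θ, rfl | rfl | rfl | rfl, rfl⟩ <;> simp [hγ]
  · rintro (rfl | rfl | rfl | rfl)
    · exact ⟨Φ, by simp⟩
    · exact ⟨M.s 0 Φ, by simp [hγ]⟩
    · exact ⟨M.s 2 Φ, by simp [hγ]⟩
    · exact ⟨M.s 0 (M.s 2 Φ), by simp [hγ]⟩

theorem isEdgeTransitive_iff :
    M.IsEdgeTransitive ↔ ∀ Φ Ψ : M.Flag, ∃ γ ∈ M.aut, γ Ψ ∈ M.edge Φ := by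
  constructor
  · intro h Φ Ψ
    obtain ⟨γ, hγ, he⟩ := h Ψ Φ
    exact ⟨γ, hγ, he ▸ Set.mem_image_of_mem γ (MulAction.mem_orbit_self Ψ)⟩
  · intro h Φ Ψ
    obtain ⟨γ, hγ, he⟩ := h Ψ Φ
    exact ⟨γ, hγ, by rw [image_edge hγ]; exact MulAction.orbit_eq_iff.2 he⟩

theorem mk_eq_mk_iff {Φ Ψ : M.Flag} :
    (Quotient.mk _ Φ : MulAction.orbitRel.Quotient M.aut M.Flag) = Quotient.mk _ Ψ ↔
      ∃ γ ∈ M.aut, γ Φ = Ψ := by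
  rw [eq_comm, Quotient.eq, MulAction.orbitRel_apply]
  constructor
  · rintro ⟨⟨γ, hγ⟩, h⟩
    exact ⟨γ, hγ, h⟩
  · rintro ⟨γ, hγ, h⟩
    exact ⟨⟨γ, hγ⟩, h⟩

/-- A labelling of the flags that is equivariant and whose classes are the flag orbits identifies
the symmetry type graph. -/
theorem symmetryTypeGraph_isIso_ofInvolutions {k : ℕ} {t : Fin 3 → Fin k → Fin k}
    (ht : ∀ i x, t i (t i x) = x) {f : M.Flag → Fin k} (hf : Function.Surjective f)
    (hs : ∀ i Φ, f (M.s i Φ) = t i (f Φ))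
    (horb : ∀ Φ Ψ, f Φ = f Ψ ↔ ∃ γ ∈ M.aut, γ Φ = Ψ) :
    M.symmetryTypeGraph.IsIso (ColouredPregraph.ofInvolutions k t ht) := by
  let F : MulAction.orbitRel.Quotient M.aut M.Flag → Fin k :=
    Quotient.lift f fun Φ Ψ h => (horb Φ Ψ).2 (mk_eq_mk_iff.1 (Quotient.sound h))
  have hF : Function.Bijective F := by
    constructor
    · rintro ⟨Φ⟩ ⟨Ψ⟩ h
      exact mk_eq_mk_iff.2 ((horb Φ Ψ).1 h)
    · intro a
      obtain ⟨Φ, rfl⟩ := hf a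
      exact ⟨Quotient.mk _ Φ, rfl⟩
  refine ⟨Equiv.ofBijective F hF, fun i O P => ?_⟩
  change (∃ Φ Ψ : M.Flag, Quotient.mk _ Φ = O ∧ Quotient.mk _ Ψ = P ∧ M.s i Φ = Ψ) ↔
    t i (F O) = F P
  constructor
  · rintro ⟨Φ, _, rfl, rfl, rfl⟩
    exact (hs i Φ).symm
  · intro h
    obtain ⟨Φ, rfl⟩ := Quotient.exists_rep O
    exact ⟨Φ, _, rfl, hF.1 ((hs i Φ).trans h), rfl⟩

end SurfaceMap

namespace ColouredPregraph

/-- There is a walk from `x` to `y` along edges with the given sequence of colours. -/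
def HasWalk (G : ColouredPregraph.{u}) : List (Fin 3) → G.V → G.V → Prop
  | [], x, y => x = y
  | i :: w, x, y => ∃ z, G.adj i x z ∧ G.HasWalk w z y

/-- The number of vertices that start a closed walk with the given sequence of colours. -/
noncomputable def closedWalkCount (G : ColouredPregraph.{u}) (w : List (Fin 3)) : ℕ :=
  Nat.card {x : G.V // G.HasWalk w x x}

theorem hasWalk_congr {G : ColouredPregraph.{u}} {H : ColouredPregraph.{v}} (e : G.V ≃ H.V)
    (he : ∀ i x y, G.adj i x y ↔ H.adj i (e x) (e y)) (w : List (Fin 3)) (x y : G.V) :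
    G.HasWalk w x y ↔ H.HasWalk w (e x) (e y) := by
  induction w generalizing x with
  | nil => exact e.injective.eq_iff.symm
  | cons i w ih => simp only [HasWalk, ← e.exists_congr_right, he, ih]

theorem IsIso.closedWalkCount_eq {G : ColouredPregraph.{u}} {H : ColouredPregraph.{v}}
    (h : G.IsIso H) (w : List (Fin 3)) : G.closedWalkCount w = H.closedWalkCount w := by
  obtain ⟨e, he⟩ := h
  exact Nat.card_congr (e.subtypeEquiv fun x => hasWalk_congr e he w x x)

theorem closedWalkCount_ofInvolutions {k : ℕ} {t : Fin 3 → Fin k → Fin k}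
    (ht : ∀ i x, t i (t i x) = x) (w : List (Fin 3)) :
    (ofInvolutions k t ht).closedWalkCount w =
      Fintype.card {x : Fin k // w.foldl (fun y i => t i y) x = x} := by
  have h : ∀ x y : Fin k,
      (ofInvolutions k t ht).HasWalk w x y ↔ w.foldl (fun y i => t i y) x = y := by
    induction w with
    | nil => exact fun _ _ => Iff.rfl
    | cons i w ih =>
      intro x y
      rw [List.foldl_cons, ← ih]
      exact ⟨fun ⟨_, hz, h⟩ => hz ▸ h, fun h => ⟨_, rfl, h⟩⟩
  rw [← Nat.card_eq_fintype_card]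
  exact Nat.card_congr (Equiv.subtypeEquivRight fun x => h x x)

end ColouredPregraph

theorem closedWalkCount_edgeTransitiveTypeGraph (a : Fin 14) :
    [[], [0], [1], [2], [0, 1], [1, 2], [0, 1, 2]].map
      (edgeTransitiveTypeGraph a).closedWalkCount =
    ![[1, 1, 1, 1, 1, 1, 1], [2, 0, 0, 0, 2, 2, 0], [2, 2, 0, 0, 0, 2, 2], [2, 0, 2, 0, 0, 0, 2],
      [2, 0, 0, 2, 2, 0, 2], [2, 2, 2, 0, 2, 0, 0], [2, 0, 2, 2, 0, 2, 0], [4, 0, 4, 0, 0, 0, 0],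
      [4, 0, 0, 0, 4, 0, 0], [4, 0, 0, 0, 0, 4, 0], [4, 0, 0, 0, 0, 0, 4], [4, 0, 2, 0, 2, 0, 0],
      [4, 0, 2, 0, 0, 2, 0], [4, 0, 2, 0, 0, 0, 2]] a := by
  fin_cases a <;>
    exact (List.map_congr_left fun w _ =>
      ColouredPregraph.closedWalkCount_ofInvolutions (by decide) w).trans (by decide)

theorem eq_of_isIso_edgeTransitiveTypeGraph {a b : Fin 14}
    (h : (edgeTransitiveTypeGraph a).IsIso (edgeTransitiveTypeGraph b)) : a = b := by
  have := closedWalkCount_edgeTransitiveTypeGraph a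
  rw [funext h.closedWalkCount_eq, closedWalkCount_edgeTransitiveTypeGraph b] at this
  clear h
  revert a b
  decide

/-- The set `V` with the involutions `t i` is isomorphic to one of the fourteen graphs. -/
def HasEdgeTransitiveType {V : Type u} (t : Fin 3 → V → V) : Prop :=
  ∃ (a : Fin 14) (k : ℕ) (t' : Fin 3 → Fin k → Fin k) (ht' : ∀ i x, t' i (t' i x) = x)
    (e : V ≃ Fin k), edgeTransitiveTypeGraph a = ColouredPregraph.ofInvolutions k t' ht' ∧
      ∀ i x, e (t i x) = t' i (e x)

theorem HasEdgeTransitiveType.of_equiv {V : Type u} {W : Type v} {t : Fin 3 → V → V}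
    {t' : Fin 3 → W → W} (e : V ≃ W) (he : ∀ i x, e (t i x) = t' i (e x))
    (h : HasEdgeTransitiveType t') : HasEdgeTransitiveType t := by
  obtain ⟨a, k, t'', ht'', e', ha, he'⟩ := h
  exact ⟨a, k, t'', ht'', e.trans e', ha, fun i x => by simp [he, he']⟩

theorem hasEdgeTransitiveType_fin_one (t : Fin 3 → Fin 1 → Fin 1) : HasEdgeTransitiveType t :=
  ⟨0, 1, _, by decide, Equiv.refl _, rfl, fun _ _ => Subsingleton.elim _ _⟩

theorem hasEdgeTransitiveType_fin_two {t : Fin 3 → Fin 2 → Fin 2} (ht : ∀ i x, t i (t i x) = x)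
    (hconn : t 0 0 = 1 ∨ t 2 0 = 1) : HasEdgeTransitiveType t := by
  have key : ∀ t : Fin 3 → Fin 2 → Fin 2, (∀ i x, t i (t i x) = x) → (t 0 0 = 1 ∨ t 2 0 = 1) →
      t = ![![1, 0], ![1, 0], ![1, 0]] ∨ t = ![![0, 1], ![1, 0], ![1, 0]] ∨
      t = ![![1, 0], ![0, 1], ![1, 0]] ∨ t = ![![1, 0], ![1, 0], ![0, 1]] ∨
      t = ![![0, 1], ![0, 1], ![1, 0]] ∨ t = ![![1, 0], ![0, 1], ![0, 1]] := by
    decide +kernel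
  rcases key t ht hconn with rfl | rfl | rfl | rfl | rfl | rfl
  · exact ⟨1, 2, _, ht, Equiv.refl _, rfl, fun _ _ => rfl⟩
  · exact ⟨2, 2, _, ht, Equiv.refl _, rfl, fun _ _ => rfl⟩
  · exact ⟨3, 2, _, ht, Equiv.refl _, rfl, fun _ _ => rfl⟩
  · exact ⟨4, 2, _, ht, Equiv.refl _, rfl, fun _ _ => rfl⟩
  · exact ⟨5, 2, _, ht, Equiv.refl _, rfl, fun _ _ => rfl⟩
  · exact ⟨6, 2, _, ht, Equiv.refl _, rfl, fun _ _ => rfl⟩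

theorem hasEdgeTransitiveType_fin_four {r : Fin 4 → Fin 4} (hr : ∀ x, r (r x) = x) :
    HasEdgeTransitiveType ![![1, 0, 3, 2], r, ![3, 2, 1, 0]] := by
  have key : ∀ r : Fin 4 → Fin 4, (∀ x, r (r x) = x) →
      ∃ (j : Fin 7) (e : Equiv.Perm (Fin 4)),
        ∀ i x, e (![![1, 0, 3, 2], r, ![3, 2, 1, 0]] i x) =
          ![![1, 0, 3, 2], ![![0, 1, 2, 3], ![1, 0, 3, 2], ![3, 2, 1, 0], ![2, 3, 0, 1],
            ![1, 0, 2, 3], ![3, 1, 2, 0], ![2, 1, 0, 3]] j, ![3, 2, 1, 0]] i (e x) := by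
    decide +kernel
  obtain ⟨j, e, he⟩ := key r hr
  refine HasEdgeTransitiveType.of_equiv e he ?_
  clear he
  fin_cases j
  · exact ⟨7, 4, _, by decide, Equiv.refl _, rfl, fun _ _ => rfl⟩
  · exact ⟨8, 4, _, by decide, Equiv.refl _, rfl, fun _ _ => rfl⟩
  · exact ⟨9, 4, _, by decide, Equiv.refl _, rfl, fun _ _ => rfl⟩
  · exact ⟨10, 4, _, by decide, Equiv.refl _, rfl, fun _ _ => rfl⟩
  · exact ⟨11, 4, _, by decide, Equiv.refl _, rfl, fun _ _ => rfl⟩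
  · exact ⟨12, 4, _, by decide, Equiv.refl _, rfl, fun _ _ => rfl⟩
  · exact ⟨13, 4, _, by decide, Equiv.refl _, rfl, fun _ _ => rfl⟩

theorem hasEdgeTransitiveType_of_transitive {V : Type u} {t : Fin 3 → V → V}
    (ht : ∀ i x, t i (t i x) = x) (hc : ∀ x, t 0 (t 2 x) = t 2 (t 0 x)) (o : V)
    (ho : ∀ x, x = o ∨ x = t 0 o ∨ x = t 2 o ∨ x = t 0 (t 2 o)) : HasEdgeTransitiveType t := by
  let f : Fin 4 → V := ![o, t 0 o, t 0 (t 2 o), t 2 o]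
  have hf : Function.Surjective f := by
    intro x
    rcases ho x with rfl | rfl | rfl | rfl
    exacts [⟨0, rfl⟩, ⟨1, rfl⟩, ⟨3, rfl⟩, ⟨2, rfl⟩]
  have hfin : Finite V := Finite.of_surjective f hf
  have hle : Nat.card V ≤ 4 := by simpa using Nat.card_le_card_of_surjective f hf
  have hfin_case : ∀ k, Nat.card V = k → ∃ (t' : Fin 3 → Fin k → Fin k) (o' : Fin k),
      (∀ i x, t' i (t' i x) = x) ∧ (∀ x, t' 0 (t' 2 x) = t' 2 (t' 0 x)) ∧
      (∀ x, x = o' ∨ x = t' 0 o' ∨ x = t' 2 o' ∨ x = t' 0 (t' 2 o')) ∧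
      (HasEdgeTransitiveType t' → HasEdgeTransitiveType t) := by
    rintro k rfl
    let e := Finite.equivFin V
    refine ⟨fun i x => e (t i (e.symm x)), e o, by simp [ht], by simp [hc], fun x => ?_,
      HasEdgeTransitiveType.of_equiv e (by simp)⟩
    simpa [← e.symm_apply_eq] using ho (e.symm x)
  obtain h | h | h | h | h : Nat.card V = 0 ∨ Nat.card V = 1 ∨ Nat.card V = 2 ∨ Nat.card V = 3 ∨
    Nat.card V = 4 := by omega
  · exact absurd h (Nat.card_pos_iff.2 ⟨⟨o⟩, hfin⟩).ne'
  · obtain ⟨t', -, -, -, -, himp⟩ := hfin_case 1 h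
    exact himp (hasEdgeTransitiveType_fin_one t')
  · obtain ⟨t', o', ht', -, ho', himp⟩ := hfin_case 2 h
    refine himp (hasEdgeTransitiveType_fin_two ht' ?_)
    clear himp
    revert t' o'
    decide +kernel
  · obtain ⟨t', o', ht', hc', ho', -⟩ := hfin_case 3 h
    have key : ∀ (a b : Fin 3 → Fin 3) (o : Fin 3),
        (∀ x, a (a x) = x ∧ b (b x) = x ∧ a (b x) = b (a x)) →
        ∃ x, ¬ (x = o ∨ x = a o ∨ x = b o ∨ x = a (b o)) := by
      decide +kernel
    obtain ⟨x, hx⟩ := key (t' 0) (t' 2) o' fun x => ⟨ht' 0 x, ht' 2 x, hc' x⟩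
    exact absurd (ho' x) hx
  · have hbij : Function.Bijective f :=
      (Nat.bijective_iff_surjective_and_card f).2 ⟨hf, by simp [h]⟩
    let e := (Equiv.ofBijective f hbij).symm
    have he : ∀ x, e (f x) = x := (Equiv.ofBijective f hbij).symm_apply_apply
    have hfe : ∀ x, f (e x) = x := (Equiv.ofBijective f hbij).apply_symm_apply
    refine HasEdgeTransitiveType.of_equiv e (fun i x => ?_)
      (hasEdgeTransitiveType_fin_four (r := fun x => e (t 1 (f x))) (by simp [hfe, he, ht]))
    obtain ⟨x, rfl⟩ := hf x
    rw [he]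
    fin_cases i
    · refine (congrArg e (?_ : _ = f (![1, 0, 3, 2] x))).trans (he _)
      fin_cases x <;> simp [f, ht]
    · rfl
    · refine (congrArg e (?_ : _ = f (![3, 2, 1, 0] x))).trans (he _)
      fin_cases x <;> simp [f, ht, hc]

namespace SurfaceMap

theorem IsEdgeTransitive.exists_symmetryTypeGraph_isIso {N : SurfaceMap.{u}}
    (hN : N.IsEdgeTransitive) :
    ∃ a : Fin 14, N.symmetryTypeGraph.IsIso (edgeTransitiveTypeGraph a) := by
  let q : N.Flag → MulAction.orbitRel.Quotient N.aut N.Flag := Quotient.mk _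
  let t : Fin 3 → MulAction.orbitRel.Quotient N.aut N.Flag →
      MulAction.orbitRel.Quotient N.aut N.Flag := fun i =>
    Quotient.lift (fun Φ => q (N.s i Φ)) fun Φ Ψ h => by
      obtain ⟨γ, hγ, rfl⟩ := mk_eq_mk_iff.1 (Quotient.sound h)
      exact mk_eq_mk_iff.2 ⟨γ, hγ, mem_aut_iff.1 hγ i Φ⟩
  have hq : Function.Surjective q := Quotient.exists_rep
  have htq : ∀ i Φ, t i (q Φ) = q (N.s i Φ) := fun _ _ => rfl
  obtain ⟨Φ⟩ := N.nonempty
  obtain ⟨a, k, t', ht', e, ha, he⟩ := hasEdgeTransitiveType_of_transitive (t := t)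
    (fun i => hq.forall.2 fun Ψ => congrArg q (N.involutive i Ψ))
    (hq.forall.2 fun Ψ => congrArg q (N.comm Ψ)) (q Φ)
    (hq.forall.2 fun Ψ => by
      obtain ⟨γ, hγ, h⟩ := isEdgeTransitive_iff.1 hN Φ Ψ
      have hΨ : q Ψ = q (γ Ψ) := mk_eq_mk_iff.2 ⟨γ, hγ, rfl⟩
      rw [hΨ]
      rcases mem_edge_iff.1 h with h | h | h | h <;> simp [h, htq])
  refine ⟨a, ha ▸ symmetryTypeGraph_isIso_ofInvolutions ht' (f := fun Φ => e (q Φ))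
    (e.surjective.comp hq) (fun i Φ => he i (q Φ)) fun Φ Ψ => ?_⟩
  rw [e.injective.eq_iff, mk_eq_mk_iff]

end SurfaceMap

/-- Three involutions on a set that satisfy the relations between the adjacencies of a medial
map, up to the colouring of its faces by the vertices and the faces of the original map. -/
structure IsMedialAction {X : Type u} (S : Fin 3 → Equiv.Perm X) : Prop where
  involutive : ∀ i x, S i (S i x) = x
  zero_ne : ∀ x, S 0 x ≠ x
  one_ne : ∀ x, S 1 x ≠ x
  comm : ∀ x, S 0 (S 2 x) = S 2 (S 0 x)
  comm_vertex : ∀ x, S 1 (S 2 (S 1 (S 2 x))) = S 2 (S 1 (S 2 (S 1 x)))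
  vertex_ne : ∀ x, S 1 (S 2 (S 1 (S 2 x))) ≠ x

namespace SurfaceMap

/-- The adjacencies of the flags of a map in terms of those of its medial map. -/
def unmedialPerm {X : Type u} (S : Fin 3 → Equiv.Perm X) : Fin 3 → Equiv.Perm X :=
  ![S 2 * S 1 * S 2, S 0, S 1]

/-- The map whose flags are the elements of `X` connected to `o` by the adjacencies
`unmedialPerm S`. -/
def unmedial {X : Type u} [Finite X] {S : Fin 3 → Equiv.Perm X} (hS : IsMedialAction S) (o : X) :
    SurfaceMap.{u} where
  Flag := MulAction.orbit (Subgroup.closure (Set.range (unmedialPerm S))) o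
  finite := inferInstance
  nonempty := ⟨⟨o, MulAction.mem_orbit_self o⟩⟩
  s i := MulAction.toPerm (⟨unmedialPerm S i, Subgroup.subset_closure ⟨i, rfl⟩⟩ :
    Subgroup.closure (Set.range (unmedialPerm S)))
  involutive := by
    rintro i ⟨x, hx⟩
    apply Subtype.ext
    change unmedialPerm S i (unmedialPerm S i x) = x
    fin_cases i <;> simp [unmedialPerm, hS.involutive]
  s_ne := by
    rintro i ⟨x, hx⟩ h
    have h' : unmedialPerm S i x = x := congrArg Subtype.val h
    fin_cases i
    · replace h' : S 2 (S 1 (S 2 x)) = x := h'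
      exact hS.one_ne (S 2 x) (by rw [← hS.involutive 2 (S 1 (S 2 x)), h'])
    · exact hS.zero_ne x h'
    · exact hS.one_ne x h'
  comm := by
    rintro ⟨x, hx⟩
    exact Subtype.ext (hS.comm_vertex x).symm
  s_zero_two_ne := by
    rintro ⟨x, hx⟩ h
    have h' : S 2 (S 1 (S 2 (S 1 x))) = x := congrArg Subtype.val h
    exact hS.vertex_ne x ((hS.comm_vertex x).trans h')
  connected := by
    refine ⟨fun x y => ?_⟩
    obtain ⟨⟨g, hg⟩, rfl⟩ := MulAction.exists_smul_eq
      (Subgroup.closure (Set.range (unmedialPerm S))) x y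
    refine ⟨⟨MulAction.toPermHom (Subgroup.closure (Set.range (unmedialPerm S)))
      (MulAction.orbit (Subgroup.closure (Set.range (unmedialPerm S))) o) ⟨g, hg⟩, ?_⟩, rfl⟩
    induction hg using Subgroup.closure_induction with
    | mem g hg => obtain ⟨i, rfl⟩ := hg; exact Subgroup.subset_closure ⟨i, rfl⟩
    | one => exact Subgroup.one_mem _
    | mul g h hg hh ihg ihh =>
      rw [← MulMemClass.mk_mul_mk _ g h hg hh, map_mul]
      exact Subgroup.mul_mem _ ihg ihh
    | inv g hg ih =>
      have := Subgroup.inv_mem _ ih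
      rwa [← map_inv] at this

/-- The adjacencies `S`, lifted to the set with coloured faces. -/
def colouredAdj {X : Type u} (S : Fin 3 → Equiv.Perm X) (i : Fin 3) (y : X × Bool) : X × Bool :=
  (S i y.1, if i = 2 then !y.2 else y.2)

theorem foldl_colouredAdj {X : Type u} {S : Fin 3 → Equiv.Perm X}
    (w : List (Fin 3)) (y : X × Bool) :
    w.foldl (fun y i => colouredAdj S i y) y =
      (w.foldl (fun x i => S i x) y.1, if Even (w.count 2) then y.2 else !y.2) := by
  induction w generalizing y with
  | nil => simp
  | cons i w ih =>
    rw [List.foldl_cons, List.foldl_cons, ih]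
    by_cases hi : i = 2
    · subst hi
      by_cases hw : Even (w.count 2) <;> simp [colouredAdj, hw, Nat.even_add_one]
    · simp [colouredAdj, hi, List.count_cons_of_ne hi]

/-- The flags of the medial map of `unmedial hS o`, as elements of `X` with a colour. -/
def unmedialEmbedding {X : Type u} [Finite X] {S : Fin 3 → Equiv.Perm X} (hS : IsMedialAction S)
    (o : X) (Φ : (unmedial hS o).medial.Flag) : X × Bool :=
  (if Φ.2 then S 2 Φ.1.1 else Φ.1.1, Φ.2)

variable {X : Type u} [Finite X] {S : Fin 3 → Equiv.Perm X} (hS : IsMedialAction S) (o : X)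

theorem unmedialEmbedding_injective : Function.Injective (unmedialEmbedding hS o) := by
  rintro ⟨⟨x, hx⟩, b⟩ ⟨⟨y, hy⟩, c⟩ h
  simp only [unmedialEmbedding, Prod.mk.injEq] at h
  obtain ⟨h, rfl⟩ := h
  have hxy : x = y := by cases b <;> simpa using h
  subst hxy
  rfl

theorem unmedialEmbedding_s (i : Fin 3) (Φ : (unmedial hS o).medial.Flag) :
    unmedialEmbedding hS o ((unmedial hS o).medial.s i Φ) =
      colouredAdj S i (unmedialEmbedding hS o Φ) := by
  obtain ⟨Φ, b⟩ := Φ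
  fin_cases i <;> cases b
  · rfl
  · exact Prod.ext (hS.comm _).symm rfl
  · rfl
  · exact Prod.ext (hS.involutive 2 _) rfl
  · rfl
  · exact Prod.ext (hS.involutive 2 _).symm rfl

theorem unmedialEmbedding_foldl (w : List (Fin 3)) (Φ : (unmedial hS o).medial.Flag) :
    unmedialEmbedding hS o (w.foldl (fun Ψ i => (unmedial hS o).medial.s i Ψ) Φ) =
      w.foldl (fun y i => colouredAdj S i y) (unmedialEmbedding hS o Φ) := by
  induction w generalizing Φ with
  | nil => rfl
  | cons i w ih => rw [List.foldl_cons, List.foldl_cons, ih, unmedialEmbedding_s]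

theorem foldl_eq_self_iff {w : List (Fin 3)} (hw : Even (w.count 2))
    (Φ : (unmedial hS o).medial.Flag) :
    w.foldl (fun Ψ i => (unmedial hS o).medial.s i Ψ) Φ = Φ ↔
      w.foldl (fun x i => S i x) (unmedialEmbedding hS o Φ).1 = (unmedialEmbedding hS o Φ).1 := by
  rw [← (unmedialEmbedding_injective hS o).eq_iff, unmedialEmbedding_foldl, foldl_colouredAdj,
    if_pos hw, Prod.ext_iff]
  simp

theorem foldl_aut {M : SurfaceMap.{u}} {γ : Equiv.Perm M.Flag} (hγ : γ ∈ M.aut)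
    (w : List (Fin 3)) (Φ : M.Flag) :
    w.foldl (fun Ψ i => M.s i Ψ) (γ Φ) = γ (w.foldl (fun Ψ i => M.s i Ψ) Φ) := by
  induction w generalizing Φ with
  | nil => rfl
  | cons i w ih => rw [List.foldl_cons, List.foldl_cons, ← mem_aut_iff.1 hγ, ih]

end SurfaceMap

section Voltage

variable {P : Type} [Group P] {k : ℕ} (t : Fin 3 → Fin k → Fin k) (v : Fin 3 → Fin k → P)

/-- One step along the edge of colour `i` in the covering of the graph `t` with voltages `v`. -/
def voltageStep (i : Fin 3) (x : P × Fin k) : P × Fin k :=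
  (v i x.2 * x.1, t i x.2)

/-- The walk with colour sequence `w` that starts at `a` is closed in the covering graph. -/
def IsClosedWalk (w : List (Fin 3)) (a : Fin k) : Prop :=
  w.foldl (fun x i => voltageStep t v i x) (1, a) = (1, a)

instance [DecidableEq P] (w : List (Fin 3)) (a : Fin k) : Decidable (IsClosedWalk t v w a) :=
  inferInstanceAs (Decidable (_ = _))

/-- The voltages `v` on the graph `t` define a covering on which the adjacencies satisfy the
relations of a medial map. -/
structure IsMedialVoltage : Prop where
  involutive : ∀ i a, IsClosedWalk t v [i, i] a
  zero_ne : ∀ a, ¬ IsClosedWalk t v [0] a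
  one_ne : ∀ a, ¬ IsClosedWalk t v [1] a
  comm : ∀ a, IsClosedWalk t v [0, 2, 0, 2] a
  comm_vertex : ∀ a, IsClosedWalk t v [1, 2, 1, 2, 1, 2, 1, 2] a
  vertex_ne : ∀ a, ¬ IsClosedWalk t v [1, 2, 1, 2] a

variable {t v}

theorem voltageStep_mul_right (i : Fin 3) (x : P × Fin k) (h : P) :
    voltageStep t v i (x.1 * h, x.2) = ((voltageStep t v i x).1 * h, (voltageStep t v i x).2) := by
  simp [voltageStep, mul_assoc]

theorem foldl_voltageStep_mul_right (w : List (Fin 3)) (x : P × Fin k) (h : P) :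
    w.foldl (fun x i => voltageStep t v i x) (x.1 * h, x.2) =
      ((w.foldl (fun x i => voltageStep t v i x) x).1 * h,
        (w.foldl (fun x i => voltageStep t v i x) x).2) := by
  induction w generalizing x with
  | nil => rfl
  | cons i w ih => rw [List.foldl_cons, List.foldl_cons, voltageStep_mul_right, ih]

theorem foldl_voltageStep_eq_self_iff (w : List (Fin 3)) (x : P × Fin k) :
    w.foldl (fun x i => voltageStep t v i x) x = x ↔ IsClosedWalk t v w x.2 := by
  have h := foldl_voltageStep_mul_right (t := t) (v := v) w (1, x.2) x.1
  rw [one_mul] at h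
  rw [IsClosedWalk, h, Prod.ext_iff, Prod.ext_iff]
  simp

theorem IsMedialVoltage.voltageStep_involutive (h : IsMedialVoltage t v) (i : Fin 3) :
    Function.Involutive (voltageStep t v i) := fun x =>
  (foldl_voltageStep_eq_self_iff [i, i] x).2 (h.involutive i x.2)

/-- The adjacencies of the covering graph. -/
def voltagePerm (h : IsMedialVoltage t v) (i : Fin 3) : Equiv.Perm (P × Fin k) :=
  (h.voltageStep_involutive i).toPerm

theorem isMedialAction_voltagePerm (h : IsMedialVoltage t v) :
    IsMedialAction (voltagePerm h) where
  involutive i := h.voltageStep_involutive i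
  zero_ne x hx := h.zero_ne x.2 ((foldl_voltageStep_eq_self_iff [0] x).1 hx)
  one_ne x hx := h.one_ne x.2 ((foldl_voltageStep_eq_self_iff [1] x).1 hx)
  comm x := by
    have h0 := h.voltageStep_involutive 0
    have h2 := h.voltageStep_involutive 2
    have := (foldl_voltageStep_eq_self_iff [0, 2, 0, 2] x).2 (h.comm x.2)
    change voltageStep t v 0 (voltageStep t v 2 x) = voltageStep t v 2 (voltageStep t v 0 x)
    change voltageStep t v 2 (voltageStep t v 0 (voltageStep t v 2 (voltageStep t v 0 x))) = x
      at this
    rw [h2.eq_iff, h0.eq_iff] at this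
    exact this.symm
  comm_vertex x := by
    have h1 := h.voltageStep_involutive 1
    have h2 := h.voltageStep_involutive 2
    have := (foldl_voltageStep_eq_self_iff [1, 2, 1, 2, 1, 2, 1, 2] x).2 (h.comm_vertex x.2)
    simp only [List.foldl_cons, List.foldl_nil] at this
    rw [h2.eq_iff, h1.eq_iff, h2.eq_iff, h1.eq_iff] at this
    exact this.symm
  vertex_ne x hx := by
    have h1 := h.voltageStep_involutive 1
    have h2 := h.voltageStep_involutive 2
    refine h.vertex_ne x.2 ((foldl_voltageStep_eq_self_iff [1, 2, 1, 2] x).1 ?_)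
    change voltageStep t v 1 (voltageStep t v 2 (voltageStep t v 1 (voltageStep t v 2 x))) = x at hx
    rw [h1.eq_iff, h2.eq_iff, h1.eq_iff, h2.eq_iff] at hx
    exact hx.symm

open SurfaceMap in
/-- A graph `t` is the symmetry type graph of an edge-transitive medial map if it carries voltages
whose covering is a medial map and in which closed walks distinguish any two vertices. -/
theorem exists_medial_symmetryTypeGraph_isIso [Finite P] [NeZero k]
    (ht : ∀ i x, t i (t i x) = x)
    (htrans : ∀ a b, b = a ∨ b = t 0 a ∨ b = t 2 a ∨ b = t 0 (t 2 a))
    (hv : IsMedialVoltage t v) (W : List (List (Fin 3)))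
    (hsep : ∀ a b, a ≠ b →
      ∃ w ∈ W, Even (w.count 2) ∧ ¬ (IsClosedWalk t v w a ↔ IsClosedWalk t v w b)) :
    ∃ M : SurfaceMap.{0}, M.medial.IsEdgeTransitive ∧
      M.medial.symmetryTypeGraph.IsIso (ColouredPregraph.ofInvolutions k t ht) := by
  have hS := isMedialAction_voltagePerm hv
  let o : P × Fin k := (1, 0)
  let ι := unmedialEmbedding hS o
  let f : (unmedial hS o).medial.Flag → Fin k := fun Φ => (ι Φ).1.2
  have hf : ∀ i Φ, f ((unmedial hS o).medial.s i Φ) = t i (f Φ) := fun i Φ =>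
    congrArg (fun y => y.1.2) (unmedialEmbedding_s hS o i Φ)
  have hedge : ∀ Φ b, ∃ Ψ ∈ (unmedial hS o).medial.edge Φ, f Ψ = b := by
    intro Φ b
    simp only [mem_edge_iff]
    rcases htrans (f Φ) b with h | h | h | h
    · exact ⟨Φ, by simp, h.symm⟩
    · exact ⟨_, Or.inr (Or.inl rfl), by rw [hf, h]⟩
    · exact ⟨_, Or.inr (Or.inr (Or.inl rfl)), by rw [hf, h]⟩
    · exact ⟨_, Or.inr (Or.inr (Or.inr rfl)), by rw [hf, hf, h]⟩
  have haut : ∀ Φ Ψ, f Φ = f Ψ → ∃ γ ∈ (unmedial hS o).medial.aut, γ Φ = Ψ := by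
    intro Φ Ψ h
    let g : (P × Fin k) × Bool → (P × Fin k) × Bool := fun y =>
      ((y.1.1 * ((ι Φ).1.1⁻¹ * (ι Ψ).1.1), y.1.2), y.2 ^^ ((ι Φ).2 ^^ (ι Ψ).2))
    refine exists_mem_aut_of_embedding (g := g) (unmedialEmbedding_injective hS o)
      (unmedialEmbedding_s hS o) (fun i y => ?_) ?_
    · refine Prod.ext (voltageStep_mul_right i y.1 _).symm ?_
      by_cases hi : i = 2 <;> simp [g, colouredAdj, hi]
    · refine Prod.ext (Prod.ext ?_ h) ?_
      · simp [g, ι]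
      · simp [g, ι]
  refine ⟨unmedial hS o, isEdgeTransitive_iff.2 fun Φ Ψ => ?_,
    symmetryTypeGraph_isIso_ofInvolutions ht (f := f) (fun b => ?_) hf fun Φ Ψ => ⟨haut Φ Ψ, ?_⟩⟩
  · obtain ⟨Θ, hΘ, h⟩ := hedge Φ (f Ψ)
    obtain ⟨γ, hγ, rfl⟩ := haut Ψ Θ h.symm
    exact ⟨γ, hγ, hΘ⟩
  · obtain ⟨Φ⟩ := (unmedial hS o).medial.nonempty
    obtain ⟨Θ, -, h⟩ := hedge Φ b
    exact ⟨Θ, h⟩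
  · rintro ⟨γ, hγ, rfl⟩
    by_contra hne
    obtain ⟨w, -, hw, h⟩ := hsep _ _ hne
    have key : ∀ Θ, w.foldl (fun Ψ i => (unmedial hS o).medial.s i Ψ) Θ = Θ ↔
        IsClosedWalk t v w (f Θ) := fun Θ =>
      (foldl_eq_self_iff hS o hw Θ).trans (foldl_voltageStep_eq_self_iff w (ι Θ).1)
    exact h (by rw [← key, ← key, foldl_aut hγ, γ.injective.eq_iff])

end Voltage

/-- Each of the fourteen graphs carries voltages in a symmetric group that realise it. -/
theorem exists_medial_edgeTransitiveTypeGraph (a : Fin 14) :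
    ∃ M : SurfaceMap.{0}, M.medial.IsEdgeTransitive ∧
      M.medial.symmetryTypeGraph.IsIso (edgeTransitiveTypeGraph a) := by
  fin_cases a
  · exact exists_medial_symmetryTypeGraph_isIso (P := Equiv.Perm (Fin 4))
      (t := ![![0], ![0], ![0]])
      (v := ![![c[0, 1] * c[2, 3]], ![c[0, 3] * c[1, 2]], ![c[0, 1]]])
      (by decide) (by decide) (by constructor <;> decide +kernel)
      []
      (by decide +kernel)
  · exact exists_medial_symmetryTypeGraph_isIso (P := Equiv.Perm (Fin 5))
      (t := ![![1, 0], ![1, 0], ![1, 0]])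
      (v := ![1, ![c[0, 3, 2, 1], c[0, 3, 2, 1]⁻¹], ![c[1, 2] * c[3, 4], c[1, 2] * c[3, 4]]])
      (by decide) (by decide) (by constructor <;> decide +kernel)
      [[0, 1, 0, 1, 2, 1, 0, 1, 2, 1, 0, 2, 1, 2]]
      (by decide +kernel)
  · exact exists_medial_symmetryTypeGraph_isIso (P := Equiv.Perm (Fin 5))
      (t := ![![0, 1], ![1, 0], ![1, 0]])
      (v := ![![c[0, 1] * c[2, 3], c[0, 1] * c[2, 3]], ![c[0, 3, 4, 1], c[0, 3, 4, 1]⁻¹], 1])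
      (by decide) (by decide) (by constructor <;> decide +kernel)
      [[0, 1, 0, 1, 0, 1, 2, 1, 2]]
      (by decide +kernel)
  · exact exists_medial_symmetryTypeGraph_isIso (P := Equiv.Perm (Fin 4))
      (t := ![![1, 0], ![0, 1], ![1, 0]])
      (v := ![1, ![c[0, 1] * c[2, 3], c[0, 2] * c[1, 3]], ![c[0, 2], c[0, 2]]])
      (by decide) (by decide) (by constructor <;> decide +kernel)
      [[0, 1, 0, 2, 1, 2]]
      (by decide +kernel)
  · exact exists_medial_symmetryTypeGraph_isIso (P := Equiv.Perm (Fin 8))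
      (t := ![![1, 0], ![1, 0], ![0, 1]])
      (v := ![1, ![c[0, 7, 4, 5, 2, 1, 3], c[0, 7, 4, 5, 2, 1, 3]⁻¹],
        ![c[0, 1] * c[2, 5] * c[3, 4] * c[6, 7], c[0, 1] * c[2, 5] * c[3, 4] * c[6, 7]]])
      (by decide) (by decide) (by constructor <;> decide +kernel)
      [[0, 1, 0, 1, 0, 1, 0, 2, 1, 0, 1, 0, 2, 1, 0, 2, 1, 2]]
      (by decide +kernel)
  · exact exists_medial_symmetryTypeGraph_isIso (P := Equiv.Perm (Fin 4))
      (t := ![![0, 1], ![0, 1], ![1, 0]])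
      (v := ![![c[0, 2] * c[1, 3], c[0, 2] * c[1, 3]], ![c[0, 3] * c[1, 2], c[0, 2] * c[1, 3]],
        1])
      (by decide) (by decide) (by constructor <;> decide +kernel)
      [[0, 1]]
      (by decide +kernel)
  · exact exists_medial_symmetryTypeGraph_isIso (P := Equiv.Perm (Fin 7))
      (t := ![![1, 0], ![0, 1], ![0, 1]])
      (v := ![1, ![c[0, 2] * c[3, 6] * c[4, 5], c[0, 1] * c[2, 5]], ![c[0, 5], c[0, 5]]])
      (by decide) (by decide) (by constructor <;> decide +kernel)
      [[0, 1, 0, 1, 0, 1, 0, 2, 1, 0, 1, 2, 1, 0, 2, 1, 2]]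
      (by decide +kernel)
  · exact exists_medial_symmetryTypeGraph_isIso (P := Equiv.Perm (Fin 4))
      (t := ![![1, 0, 3, 2], ![0, 1, 2, 3], ![3, 2, 1, 0]])
      (v := ![1, ![c[0, 3] * c[1, 2], c[1, 2], c[0, 3], c[0, 1] * c[2, 3]], 1])
      (by decide) (by decide) (by constructor <;> decide +kernel)
      [[0, 1, 0, 1, 2, 1, 2], [0, 1, 2, 1, 0, 1, 2], [0, 1, 2, 1, 0, 2, 1]]
      (by decide +kernel)
  · exact exists_medial_symmetryTypeGraph_isIso (P := Equiv.Perm (Fin 7))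
      (t := ![![1, 0, 3, 2], ![1, 0, 3, 2], ![3, 2, 1, 0]])
      (v := ![1, ![c[0, 1, 3] * c[4, 5, 6], (c[0, 1, 3] * c[4, 5, 6])⁻¹, c[0, 6, 4, 3, 1, 2],
        c[0, 6, 4, 3, 1, 2]⁻¹], 1])
      (by decide) (by decide) (by constructor <;> decide +kernel)
      [[0, 1, 0, 1, 0, 1], [0, 1, 0, 1, 0, 1, 2, 1, 0, 2, 1, 0, 1, 2, 1, 0, 2, 1, 0, 2, 1, 2],
        [0, 1, 0, 2, 1, 0, 1, 0, 1, 2, 1, 0, 2, 1, 0, 1, 2, 1, 0, 2, 1, 2]]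
      (by decide +kernel)
  · exact exists_medial_symmetryTypeGraph_isIso (P := Equiv.Perm (Fin 9))
      (t := ![![1, 0, 3, 2], ![3, 2, 1, 0], ![3, 2, 1, 0]])
      (v := ![1, ![c[0, 8, 7, 2] * c[1, 6] * c[3, 5], c[0, 2] * c[1, 6, 4, 5] * c[7, 8],
        (c[0, 2] * c[1, 6, 4, 5] * c[7, 8])⁻¹, (c[0, 8, 7, 2] * c[1, 6] * c[3, 5])⁻¹], 1])
      (by decide) (by decide) (by constructor <;> decide +kernel)
      [[0, 1, 0, 1, 2, 1, 0, 2, 1, 0, 1, 2, 1, 2],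
        [0, 1, 0, 1, 0, 1, 0, 1, 2, 1, 0, 1, 0, 1, 2, 1, 0, 2, 1, 0, 1, 2],
        [0, 1, 0, 1, 0, 1, 2, 1, 0, 1, 0, 1, 2, 1, 0, 1, 0, 2, 1, 0, 1, 2]]
      (by decide +kernel)
  · exact exists_medial_symmetryTypeGraph_isIso (P := Equiv.Perm (Fin 7))
      (t := ![![1, 0, 3, 2], ![2, 3, 0, 1], ![3, 2, 1, 0]])
      (v := ![1, ![c[0, 3, 2] * c[1, 5, 4], c[0, 6, 2, 3, 1, 5], (c[0, 3, 2] * c[1, 5, 4])⁻¹,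
        c[0, 6, 2, 3, 1, 5]⁻¹], 1])
      (by decide) (by decide) (by constructor <;> decide +kernel)
      [[0, 1, 0, 1, 0, 1, 0, 2, 1, 0, 1, 0, 1, 2],
        [0, 1, 0, 1, 0, 1, 0, 1, 0, 1, 0, 1, 2, 1, 0, 1, 2, 1, 0, 2, 1, 2],
        [0, 1, 0, 1, 0, 1, 0, 1, 0, 1, 2, 1, 0, 1, 2, 1, 0, 2, 1, 0, 2, 1]]
      (by decide +kernel)
  · exact exists_medial_symmetryTypeGraph_isIso (P := Equiv.Perm (Fin 5))
      (t := ![![1, 0, 3, 2], ![1, 0, 2, 3], ![3, 2, 1, 0]])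
      (v := ![1, ![c[0, 2, 1, 4], c[0, 2, 1, 4]⁻¹, c[0, 3] * c[1, 4], c[1, 2] * c[3, 4]], 1])
      (by decide) (by decide) (by constructor <;> decide +kernel)
      [[0, 1, 0, 1, 0, 1, 0, 1], [0, 1, 0, 1, 0, 1, 2, 1, 0, 1, 2],
        [0, 1, 0, 1, 2, 1, 0, 1, 0, 1, 2]]
      (by decide +kernel)
  · exact exists_medial_symmetryTypeGraph_isIso (P := Equiv.Perm (Fin 4))
      (t := ![![1, 0, 3, 2], ![3, 1, 2, 0], ![3, 2, 1, 0]])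
      (v := ![1, ![c[0, 1, 3, 2], c[0, 3] * c[1, 2], c[1, 2], c[0, 1, 3, 2]⁻¹], 1])
      (by decide) (by decide) (by constructor <;> decide +kernel)
      [[0, 1, 0, 1, 2, 1, 2], [0, 1, 2, 1, 0, 1, 2], [0, 1, 2, 1, 0, 2, 1]]
      (by decide +kernel)
  · exact exists_medial_symmetryTypeGraph_isIso (P := Equiv.Perm (Fin 5))
      (t := ![![1, 0, 3, 2], ![2, 1, 0, 3], ![3, 2, 1, 0]])
      (v := ![1, ![c[1, 4, 3, 2], c[0, 4] * c[1, 2], c[1, 4, 3, 2]⁻¹, c[0, 1] * c[2, 3]], 1])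
      (by decide) (by decide) (by constructor <;> decide +kernel)
      [[0, 1, 0, 1, 0, 1, 2, 1, 0, 1, 2], [0, 1, 0, 1, 0, 2, 1, 0, 1, 2, 1],
        [0, 1, 0, 1, 2, 1, 0, 1, 0, 1, 2]]
      (by decide +kernel)

/-- The fourteen graphs are pairwise non-isomorphic, they are all the symmetry type graphs of
edge-transitive maps, and each of them is the symmetry type graph of a medial map. -/
theorem mainTheorem1 :
    (∀ a b : Fin 14,
      (edgeTransitiveTypeGraph a).IsIso (edgeTransitiveTypeGraph b) → a = b) ∧
    (∀ N : SurfaceMap.{u}, N.IsEdgeTransitive →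
      ∃ a : Fin 14, N.symmetryTypeGraph.IsIso (edgeTransitiveTypeGraph a)) ∧
    (∀ a : Fin 14, ∃ M : SurfaceMap.{0}, M.medial.IsEdgeTransitive ∧
      M.medial.symmetryTypeGraph.IsIso (edgeTransitiveTypeGraph a)) := by
  exact ⟨fun _ _ => eq_of_isIso_edgeTransitiveTypeGraph,
    fun _ hN => hN.exists_symmetryTypeGraph_isIso, exists_medial_edgeTransitiveTypeGraph⟩
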